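/- Let $\mathcal K$ be a simplicial complex on a finite totally ordered vertex set $S$, i.e. a family of subsets of $S$ (faces) containing $\emptyset$ and closed under passing to subsets, and suppose that $\mathcal K$ has no ghost vertices, i.e. $\{x\}\in\mathcal K$ for all $x\in S$. Write $\langle\sigma\rangle$ for the complex of all subsets of $\sigma\subseteq S$. Suppose that $\mathcal K$ is wedge-decomposable: there are simplicial complexes $\mathcal K^1,\mathcal K^2$ on $S$ and a possibly empty set $\sigma\subseteq S$ such that $\mathcal K=\mathcal K^1\cup\mathcal K^2$, $\mathcal K^1\cap\mathcal K^2=\langle\sigma\rangle$, and $\sigma$ is a proper face of both $\mathcal K^1$ and $\mathcal K^2$ (that is, $\sigma\in\mathcal K^i$ and $\mathcal K^i\neq\langle\sigma\rangle$ for $i=1,2$). For $J\subseteq S$ let $\mathcal K_J=\{\tau\in\mathcal K:\tau\subseteq J\}$, and let $\tilde H_p$ be reduced simplicial homology with integer coefficients (the homology of the simplicial chain complex augmented by the empty face in degree $-1$). For $k,l\in\mathbb Z$ put $$CH_{-k,2l}(\mathcal Z_{\mathcal K})=\bigoplus_{J\subseteq S,\ |J|=l}\tilde H_{l-k-1}(\mathcal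 K_J),$$ with the differential $d:CH_{-k,2l}(\mathcal Z_{\mathcal K})\to CH_{-k-1,2l+2}(\mathcal Z_{\mathcal K})$ that on $\tilde H_p(\mathcal K_J)$, $p=l-k-1$, is $(-1)^{p-1}\sum_{x\in S\setminus J}\varepsilon(x,J)\,\phi_{p;J,x}$, where $\varepsilon(x,J)=(-1)^{|\{j\in J:j<x\}|}$ and $\phi_{p;J,x}:\tilde H_p(\mathcal K_J)\to\tilde H_p(\mathcal K_{J\cup\{x\}})$ is induced by inclusion. The double homology $HH_{-k,2l}(\mathcal Z_{\mathcal K})$ of the moment-angle complex $\mathcal Z_{\mathcal K}$ is the cohomology of this complex at $CH_{-k,2l}(\mathcal Z_{\mathcal K})$. Likewise, for $n,l\in\mathbb Z$, $HH_n^l(\mathcal Z_{\mathcal K})$ is the $l$-th cohomology of the complex $CH_n^*(\mathcal Z_{\mathcal K})$, $CH_n^l(\mathcal Z_{\mathcal K})=\bigoplus_{|J|=l}\tilde H_{n-1}(\mathcal K_J)$, with the same differential. Then, for all integers $n,l$, $$HH_n^l(\mathcal Z_{\mathcal K})\cong\begin{cases}\mathbb Z&\text{if }(n,l)=(0,0)\text{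 or }(1,2),\\0&\text{otherwise,}\end{cases}$$ and, equivalently, for all integers $k,l$, $$HH_{-k,2l}(\mathcal Z_{\mathcal K})\cong\begin{cases}\mathbb Z&\text{if }(-k,2l)=(0,0)\text{ or }(-1,4),\\0&\text{otherwise.}\end{cases}$$ -/

import Mathlib

/-- A simplicial complex on the vertex set `V`: a family of finite subsets of `V` (the faces) that
contains `∅` and is closed under taking subsets. An `x : V` need not be a face `{x}`
(ghost vertices are allowed). -/
@[ext] structure SimplicialCx (V : Type*) where
  faces : Set (Finset V)
  empty_mem : ∅ ∈ faces
  down_closed : ∀ s ∈ faces, ∀ t : Finset V, t ⊆ s → t ∈ faces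

namespace SimplicialCx

/-- `x` is a ghost vertex of `K` if `{x}` is not a face. -/
def IsGhost {V : Type*} (K : SimplicialCx V) (x : V) : Prop := ({x} : Finset V) ∉ K.faces

/-- The simplicial complex `⟨σ⟩` generated by `σ`: all subsets of `σ`. -/
def simplex {V : Type*} (σ : Finset V) : SimplicialCx V where
  faces := {t | t ⊆ σ}
  empty_mem := Finset.empty_subset σ
  down_closed := fun _ hs _ hts => hts.trans hs

/-- The full subcomplex `K_J`, whose faces are the faces of `K` that are contained in `J`. -/
def full {V : Type*} (K : SimplicialCx V) (J : Finset V) : SimplicialCx V where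
  faces := {t | t ∈ K.faces ∧ t ⊆ J}
  empty_mem := ⟨K.empty_mem, Finset.empty_subset J⟩
  down_closed := fun s hs t hts => ⟨K.down_closed s hs.1 t hts, hts.trans hs.2⟩

/-- `σ` is a proper face of the complex `K`: it is a face, and `K` is not just `⟨σ⟩`. -/
def IsProperFace {V : Type*} (K : SimplicialCx V) (σ : Finset V) : Prop :=
  σ ∈ K.faces ∧ K ≠ simplex σ

/-- `K = K₁ ⊔_σ K₂`: `K` is the union of `K₁` and `K₂`, which intersect exactly in `⟨σ⟩`, where
`σ` is a (possibly empty) proper face of both. -/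
structure IsFaceSum {V : Type*} (K K₁ K₂ : SimplicialCx V) (σ : Finset V) : Prop where
  union_eq : K.faces = K₁.faces ∪ K₂.faces
  inter_eq : K₁.faces ∩ K₂.faces = (simplex σ).faces
  proper_left : K₁.IsProperFace σ
  proper_right : K₂.IsProperFace σ

/-- `K` is wedge-decomposable if `K = K₁ ⊔_σ K₂` for some `K₁`, `K₂`, `σ`. -/
def WedgeDecomposable {V : Type*} (K : SimplicialCx V) : Prop :=
  ∃ (K₁ K₂ : SimplicialCx V) (σ : Finset V), IsFaceSum K K₁ K₂ σ

/-- `ε(x, J) = (-1) ^ |{j ∈ J : j < x}|`. -/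
def sgn {V : Type*} [LinearOrder V] (x : V) (J : Finset V) : ℤ :=
  (-1) ^ (J.filter (· < x)).card

/-- The simplicial boundary on the free abelian group on all finite subsets of `V` (a subset
`{v₀ < ⋯ < v_p}` stands for the oriented simplex `[v₀, …, v_p]`):
`∂ [v₀, …, v_p] = ∑ i, (-1) ^ i [v₀, …, v̂_i, …, v_p]`, the empty subset being a simplex of
dimension `-1` (so that `∂ [v₀] = [∅]` is the augmentation). -/
noncomputable def boundary (V : Type*) [LinearOrder V] : (Finset V →₀ ℤ) →ₗ[ℤ] (Finset V →₀ ℤ) :=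
  Finsupp.linearCombination ℤ fun s : Finset V =>
    ∑ x ∈ s, sgn x s • Finsupp.single (s.erase x) (1 : ℤ)

/-- The group `C_p(K)` of augmented simplicial `p`-chains of `K` : the free abelian group on the
faces with `p + 1` elements. -/
def chains {V : Type*} (K : SimplicialCx V) (p : ℤ) : Submodule ℤ (Finset V →₀ ℤ) :=
  Finsupp.supported ℤ ℤ {s | s ∈ K.faces ∧ (s.card : ℤ) = p + 1}

/-- The `p`-cycles of the augmented simplicial chain complex of `K`. -/
noncomputable def cycles {V : Type*} [LinearOrder V] (K : SimplicialCx V) (p : ℤ) :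
    Submodule ℤ (Finset V →₀ ℤ) :=
  K.chains p ⊓ LinearMap.ker (boundary V)

/-- The `p`-boundaries of the augmented simplicial chain complex of `K`. -/
noncomputable def boundaries {V : Type*} [LinearOrder V] (K : SimplicialCx V) (p : ℤ) :
    Submodule ℤ (Finset V →₀ ℤ) :=
  (K.chains (p + 1)).map (boundary V)

/-- The reduced simplicial homology group `H̃_p(K)` with integer coefficients. -/
abbrev RedHomology {V : Type*} [LinearOrder V] (K : SimplicialCx V) (p : ℤ) : Type _ :=
  K.cycles p ⧸ (K.boundaries p).submoduleOf (K.cycles p)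

theorem chains_mono {V : Type*} {K L : SimplicialCx V} (h : K.faces ⊆ L.faces) (p : ℤ) :
    K.chains p ≤ L.chains p :=
  Finsupp.supported_mono fun _ hs => ⟨h hs.1, hs.2⟩

theorem cycles_mono {V : Type*} [LinearOrder V] {K L : SimplicialCx V}
    (h : K.faces ⊆ L.faces) (p : ℤ) : K.cycles p ≤ L.cycles p :=
  inf_le_inf_right _ (chains_mono h p)

theorem boundaries_mono {V : Type*} [LinearOrder V] {K L : SimplicialCx V}
    (h : K.faces ⊆ L.faces) (p : ℤ) : K.boundaries p ≤ L.boundaries p :=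
  Submodule.map_mono (chains_mono h (p + 1))

/-- The map `H̃_p(K) → H̃_p(L)` induced by an inclusion of complexes `K ⊆ L`. -/
noncomputable def homologyMap {V : Type*} [LinearOrder V] {K L : SimplicialCx V}
    (h : K.faces ⊆ L.faces) (p : ℤ) : K.RedHomology p →ₗ[ℤ] L.RedHomology p :=
  Submodule.mapQ _ _ (Submodule.inclusion (cycles_mono h p))
    (fun _ hx => boundaries_mono h p hx)

theorem full_mono {V : Type*} (K : SimplicialCx V) {I J : Finset V} (h : I ⊆ J) :
    (K.full I).faces ⊆ (K.full J).faces :=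
  fun _ ht => ⟨ht.1, ht.2.trans h⟩

/-- The direct sum `⨁_J H̃_p(K_J)` over all subsets `J` of the (finite) vertex set. -/
abbrev CHTotal {V : Type*} [LinearOrder V] (K : SimplicialCx V) (p : ℤ) : Type _ :=
  ∀ J : Finset V, (K.full J).RedHomology p

/-- The summand `⨁_{|J| = l} H̃_p(K_J)`. -/
def CHPart {V : Type*} [LinearOrder V] (K : SimplicialCx V) (p l : ℤ) :
    Submodule ℤ (K.CHTotal p) where
  carrier := {c | ∀ J : Finset V, (J.card : ℤ) ≠ l → c J = 0}
  add_mem' := fun ha hb J hJ => by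
    rw [Pi.add_apply, ha J hJ, hb J hJ, add_zero]
  zero_mem' := fun _ _ => rfl
  smul_mem' := fun r c hc J hJ => by
    rw [Pi.smul_apply, hc J hJ, smul_zero]

/-- The differential: on the summand `H̃_p(K_J)` it is
`(-1) ^ (p - 1) ∑_{x ∉ J} ε(x, J) φ_{p;J,x}`, where `φ_{p;J,x} : H̃_p(K_J) → H̃_p(K_{J ∪ {x}})` is
induced by the inclusion. It is written by its components: that at `J` collects the contributions
of the subsets `J \ {x}`, `x ∈ J`. -/
noncomputable def diff {V : Type*} [LinearOrder V] (K : SimplicialCx V) (p : ℤ) :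
    K.CHTotal p →ₗ[ℤ] K.CHTotal p :=
  LinearMap.pi fun J => ((p - 1).negOnePow : ℤ) •
    ∑ x ∈ J, sgn x (J.erase x) •
      (homologyMap (K.full_mono (J.erase_subset x)) p ∘ₗ LinearMap.proj (J.erase x))

/-- The cohomology of `⨁_{|J| = l - 1} H̃_p(K_J) → ⨁_{|J| = l} H̃_p(K_J) → ⨁_{|J| = l + 1} H̃_p(K_J)`
at the middle term. -/
abbrev DoubleHomology {V : Type*} [LinearOrder V] (K : SimplicialCx V) (p l : ℤ) : Type _ :=
  ↥(K.CHPart p l ⊓ LinearMap.ker (K.diff p)) ⧸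
    ((K.CHPart p (l - 1)).map (K.diff p)).submoduleOf (K.CHPart p l ⊓ LinearMap.ker (K.diff p))

/-- `HH_n^l(Z_K)`, the cohomology in degree `l` of `CH_n^*`, `CH_n^l = ⨁_{|J| = l} H̃_{n-1}(K_J)`. -/
abbrev HH {V : Type*} [LinearOrder V] (K : SimplicialCx V) (n l : ℤ) : Type _ :=
  K.DoubleHomology (n - 1) l

/-- `HH_{-k,2l}(Z_K)`, the cohomology of `CH_{*,*}` in bidegree `(-k, 2l)`, where
`CH_{-k,2l} = ⨁_{|J| = l} H̃_{l-k-1}(K_J)`. -/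
abbrev BigradedHH {V : Type*} [LinearOrder V] (K : SimplicialCx V) (k l : ℤ) : Type _ :=
  K.DoubleHomology (l - k - 1) l

theorem sgn_erase_self {V : Type*} [LinearOrder V] (x : V) (J : Finset V) :
    sgn x (J.erase x) = sgn x J := by
  unfold sgn
  congr 2
  ext y
  simp only [Finset.mem_filter, Finset.mem_erase]
  exact ⟨fun h => ⟨h.1.2, h.2⟩, fun h => ⟨⟨h.2.ne, h.1⟩, h.2⟩⟩

theorem sgn_mul_sgn_of_lt {V : Type*} [LinearOrder V] {x y : V} {J : Finset V} (hx : x ∈ J)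
    (h : x < y) : sgn x J * sgn y (J.erase x) = -(sgn y J * sgn x (J.erase y)) := by
  have h1 : (J.erase y).filter (· < x) = J.filter (· < x) := by
    ext z
    simp only [Finset.mem_filter, Finset.mem_erase]
    exact ⟨fun h => ⟨h.1.2, h.2⟩, fun h' => ⟨⟨(h'.2.trans h).ne, h'.1⟩, h'.2⟩⟩
  have h2 : ((J.erase x).filter (· < y)).card + 1 = (J.filter (· < y)).card := by
    rw [Finset.filter_erase]
    exact Finset.card_erase_add_one (Finset.mem_filter.2 ⟨hx, h⟩)
  unfold sgn
  rw [h1, ← h2, pow_succ]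
  ring

theorem sgn_mul_sgn {V : Type*} [LinearOrder V] {x y : V} {J : Finset V} (hx : x ∈ J)
    (hy : y ∈ J) (h : x ≠ y) :
    sgn x J * sgn y (J.erase x) = -(sgn y J * sgn x (J.erase y)) := by
  rcases h.lt_or_gt with h | h
  · exact sgn_mul_sgn_of_lt hx h
  · rw [sgn_mul_sgn_of_lt hy h, neg_neg]

/-- A double sum over ordered pairs of distinct elements that is antisymmetric vanishes. -/
theorem sum_erase_antisymm {V M : Type*} [LinearOrder V] [AddCommGroup M] (J : Finset V)
    (f : V → V → M) (hf : ∀ x ∈ J, ∀ y ∈ J, x ≠ y → f x y + f y x = 0) :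
    ∑ x ∈ J, ∑ y ∈ J.erase x, f x y = 0 := by
  rw [Finset.sum_sigma']
  refine Finset.sum_involution (fun a _ => ⟨a.2, a.1⟩) ?_ ?_ ?_ ?_
  · rintro ⟨x, y⟩ h
    simp only [Finset.mem_sigma, Finset.mem_erase] at h
    exact hf x h.1 y h.2.2 (Ne.symm h.2.1)
  · rintro ⟨x, y⟩ h _ h'
    simp only [Finset.mem_sigma, Finset.mem_erase] at h
    simp only [Sigma.mk.injEq, heq_eq_eq] at h'
    exact h.2.1 h'.1
  · rintro ⟨x, y⟩ h
    simp only [Finset.mem_sigma, Finset.mem_erase] at h ⊢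
    exact ⟨h.2.2, Ne.symm h.2.1, h.1⟩
  · rintro ⟨x, y⟩ _
    rfl

/-- The simplicial boundary squares to zero. -/
theorem boundary_boundary {V : Type*} [LinearOrder V] (c : Finset V →₀ ℤ) :
    boundary V (boundary V c) = 0 := by
  suffices h : boundary V ∘ₗ boundary V = 0 from LinearMap.congr_fun h c
  refine Finsupp.lhom_ext' fun s => LinearMap.ext_ring ?_
  simp only [boundary, LinearMap.comp_apply, Finsupp.lsingle_apply,
    Finsupp.linearCombination_single, map_sum, map_smul, Finset.smul_sum,
    LinearMap.zero_apply, smul_smul, one_mul]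
  refine sum_erase_antisymm s _ fun x hx y hy hxy => ?_
  rw [sgn_mul_sgn hx hy hxy, Finset.erase_right_comm, ← add_smul, neg_add_cancel, zero_smul]

theorem boundaries_le_cycles {V : Type*} [LinearOrder V] (K : SimplicialCx V) (p : ℤ) :
    K.boundaries p ≤ K.cycles p := by
  rw [boundaries, chains, Finsupp.supported_eq_span_single, Submodule.map_span_le]
  rintro _ ⟨s, ⟨hs, hc⟩, rfl⟩
  refine ⟨?_, boundary_boundary _⟩
  rw [boundary, Finsupp.linearCombination_single, one_smul]
  refine Submodule.sum_mem _ fun x hx => Submodule.smul_mem _ _ ?_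
  refine Finsupp.single_mem_supported ℤ _ ⟨K.down_closed s hs _ (s.erase_subset x), ?_⟩
  have := Finset.card_erase_add_one hx
  omega

theorem homologyMap_comp {V : Type*} [LinearOrder V] {K L M : SimplicialCx V}
    (h : K.faces ⊆ L.faces) (h' : L.faces ⊆ M.faces) (p : ℤ) (a : K.RedHomology p) :
    homologyMap h' p (homologyMap h p a) = homologyMap (h.trans h') p a := by
  obtain ⟨a, rfl⟩ := Submodule.Quotient.mk_surjective _ a
  rfl

theorem homologyMap_congr {V : Type*} [LinearOrder V] (K : SimplicialCx V) (p : ℤ)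
    (c : K.CHTotal p) {I I' J : Finset V} (e : I = I') (h : I ⊆ J) (h' : I' ⊆ J) :
    homologyMap (K.full_mono h) p (c I) = homologyMap (K.full_mono h') p (c I') := by
  subst e
  rfl

/-- The differential squares to zero. -/
theorem diff_diff {V : Type*} [LinearOrder V] (K : SimplicialCx V) (p : ℤ) (c : K.CHTotal p) :
    K.diff p (K.diff p c) = 0 := by
  funext J
  simp only [diff, LinearMap.pi_apply, LinearMap.smul_apply, LinearMap.sum_apply,
    LinearMap.comp_apply, LinearMap.proj_apply, map_smul, map_sum, Finset.smul_sum,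
    homologyMap_comp, smul_smul, Pi.zero_apply]
  refine sum_erase_antisymm J _ fun x hx y hy hxy => ?_
  have h1 : (J.erase x).erase y ⊆ J := (Finset.erase_subset _ _).trans (Finset.erase_subset _ _)
  have h2 : (J.erase y).erase x ⊆ J := (Finset.erase_subset _ _).trans (Finset.erase_subset _ _)
  rw [homologyMap_congr K p c Finset.erase_right_comm h1 h2, ← add_smul]
  simp only [sgn_erase_self]
  have := sgn_mul_sgn hx hy hxy
  convert zero_smul ℤ _
  linear_combination (((p - 1).negOnePow : ℤ) * ((p - 1).negOnePow : ℤ)) * this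

/-- The differential maps the summand `|J| = l` to the summand `|J| = l + 1`. -/
theorem diff_mem {V : Type*} [LinearOrder V] (K : SimplicialCx V) (p l : ℤ) (c : K.CHTotal p)
    (hc : c ∈ K.CHPart p l) : K.diff p c ∈ K.CHPart p (l + 1) := by
  intro J hJ
  simp only [diff, LinearMap.pi_apply, LinearMap.smul_apply, LinearMap.sum_apply,
    LinearMap.comp_apply, LinearMap.proj_apply]
  rw [Finset.sum_eq_zero, smul_zero]
  intro x hx
  have := Finset.card_erase_add_one hx
  rw [hc (J.erase x) (by omega), map_zero, smul_zero]

end SimplicialCx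

namespace SimplicialCx

/-! Fix p = n - 1 and read J ↦ H̃_p(K_J) as coefficients on the cube of subsets. Inserting a ghost
vertex does not change K_J, so a complex with a ghost vertex has a contractible cube
(`IsCocycle.isCoboundary_of_isGhost`). Since σ is proper, each of K₁, K₂ misses a vertex of the
other, so both are of this kind.

In Mayer–Vietoris the intersection ⟨σ ∩ J⟩ is acyclic in degrees ≥ 0. For p ≥ 1 this makes H̃_p(K_J)
the direct sum of the two pieces, and everything vanishes (`IsCocycle.isCoboundary_of_add`). For p =
0 the sum of the pieces is only a subgroup: the quotient is ℤ, via `vertexSum`, when J misses σ and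
meets both the vertices private to K₁ and those private to K₂, and is zero otherwise. These copies
of ℤ have cube cohomology a single ℤ, detected on a pair {x₁, x₂} of private vertices
(`exists_cubeDiff_eq`, `IsFaceSum.isCoboundary_of_vertexSum`). For p = -1 only J = ∅ contributes,
which gives the other ℤ.

The argument runs on families of representing cycles and passes to classes at the end. -/

/-- The differential of the cube of subsets with constant coefficients `M`. -/
def cubeDiff {V M : Type*} [LinearOrder V] [AddCommGroup M] (f : Finset V → M) (J : Finset V) : M :=
  ∑ x ∈ J, sgn x J • f (J.erase x)

/-- The contracting homotopy of the cube of subsets in the direction of the vertex `x`. -/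
def cubeHtpy {V M : Type*} [LinearOrder V] [AddCommGroup M] (x : V) (f : Finset V → M)
    (J : Finset V) : M :=
  if x ∈ J then 0 else sgn x J • f (insert x J)

/-! ### The cube of subsets and its contracting homotopies. -/

section Cube

variable {V M : Type*} [LinearOrder V] [AddCommGroup M]

theorem sgn_mul_self (x : V) (J : Finset V) : sgn x J * sgn x J = 1 := by
  unfold sgn
  rw [← mul_pow]
  norm_num

theorem sgn_insert_self (x : V) (J : Finset V) : sgn x (insert x J) = sgn x J := by
  rw [← sgn_erase_self, ← sgn_erase_self x J, Finset.erase_insert_eq_erase]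

theorem cubeDiff_congr {f g : Finset V → M} {J : Finset V}
    (h : ∀ x ∈ J, f (J.erase x) = g (J.erase x)) :
    cubeDiff f J = cubeDiff g J :=
  Finset.sum_congr rfl fun x hx => by rw [h x hx]

theorem cubeDiff_add (f g : Finset V → M) (J : Finset V) :
    cubeDiff (fun J => f J + g J) J = cubeDiff f J + cubeDiff g J := by
  simp only [cubeDiff, smul_add, Finset.sum_add_distrib]

theorem cubeDiff_sub (f g : Finset V → M) (J : Finset V) :
    cubeDiff (fun J => f J - g J) J = cubeDiff f J - cubeDiff g J := by
  simp only [cubeDiff, smul_sub, Finset.sum_sub_distrib]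

theorem map_cubeDiff {N : Type*} [AddCommGroup N] (q : M →ₗ[ℤ] N) (f : Finset V → M)
    (J : Finset V) : cubeDiff (fun I => q (f I)) J = q (cubeDiff f J) := by
  simp only [cubeDiff, map_sum, map_smul]

theorem cubeDiff_cubeDiff (f : Finset V → M) (J : Finset V) : cubeDiff (cubeDiff f) J = 0 := by
  simp only [cubeDiff, Finset.smul_sum, smul_smul]
  refine sum_erase_antisymm J _ fun x hx y hy hxy => ?_
  rw [sgn_mul_sgn hx hy hxy, Finset.erase_right_comm, ← add_smul, neg_add_cancel, zero_smul]

/-- If x ∈ J, only the removal of x contributes on the left. If x ∉ J, removing x from `insert x J`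
returns f J, and the other terms cancel in pairs by anticommutation of signs. -/
theorem cubeDiff_cubeHtpy (x : V) (f : Finset V → M) (J : Finset V) :
    cubeDiff (cubeHtpy x f) J = f J - cubeHtpy x (cubeDiff f) J := by
  by_cases hx : x ∈ J
  · rw [cubeDiff, Finset.sum_eq_single_of_mem x hx, cubeHtpy, cubeHtpy, if_neg (J.notMem_erase x),
      if_pos hx, sub_zero, sgn_erase_self, smul_smul, sgn_mul_self, one_smul,
      Finset.insert_erase hx]
    intro y _ hyx
    rw [cubeHtpy, if_pos (Finset.mem_erase.2 ⟨hyx.symm, hx⟩), smul_zero]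
  · rw [cubeHtpy, if_neg hx, cubeDiff, cubeDiff, Finset.sum_insert hx, smul_add, smul_smul,
      sgn_insert_self, sgn_mul_self, one_smul, Finset.erase_insert hx, sub_add_cancel_left,
      Finset.smul_sum, ← Finset.sum_neg_distrib]
    refine Finset.sum_congr rfl fun y hy => ?_
    have hyx : y ≠ x := fun h => hx (h ▸ hy)
    rw [cubeHtpy, if_neg fun h => hx (Finset.mem_of_mem_erase h), smul_smul, smul_smul, ← neg_smul,
      Finset.erase_insert_of_ne hyx.symm]
    congr 1
    have h := sgn_mul_sgn (Finset.mem_insert_of_mem hy) (Finset.mem_insert_self x J) hyx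
    rw [sgn_insert_self, Finset.erase_insert hx, Finset.erase_insert_of_ne hyx.symm,
      sgn_insert_self] at h
    have h1 := sgn_mul_self x J
    have h2 := sgn_mul_self x (J.erase y)
    -- Multiply the exchange rule by both signs of x; their squares are 1.
    linear_combination (sgn x J * sgn x (J.erase y)) * h -
      (sgn x J * sgn y (insert x J)) * h2 - (sgn y J * sgn x (J.erase y)) * h1

end Cube

/-! ### Acyclicity of a simplex. -/

section Simplex

variable {V : Type*} [LinearOrder V]

theorem boundary_single (s : Finset V) :
    boundary V (Finsupp.single s 1) = ∑ x ∈ s, sgn x s • Finsupp.single (s.erase x) (1 : ℤ) := by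
  rw [boundary, Finsupp.linearCombination_single, one_smul]

/-- The cone operator with apex `v`. -/
noncomputable def cone (v : V) : (Finset V →₀ ℤ) →ₗ[ℤ] (Finset V →₀ ℤ) :=
  Finsupp.linearCombination ℤ fun s : Finset V =>
    cubeHtpy v (fun t => Finsupp.single t (1 : ℤ)) s

/-- This is the cube homotopy identity for the function t ↦ [t], whose `cubeDiff` is the boundary
and whose `cubeHtpy` is the cone. -/
theorem boundary_cone (v : V) (c : Finset V →₀ ℤ) :
    boundary V (cone v c) = c - cone v (boundary V c) := by
  suffices h : boundary V ∘ₗ cone v = LinearMap.id - cone v ∘ₗ boundary V from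
    LinearMap.congr_fun h c
  refine Finsupp.lhom_ext' fun s => LinearMap.ext_ring ?_
  simp only [LinearMap.comp_apply, Finsupp.lsingle_apply, LinearMap.sub_apply, LinearMap.id_apply,
    boundary_single, map_sum, map_smul]
  have key : ∀ t : Finset V, cone v (Finsupp.single t 1) =
      cubeHtpy v (fun t => Finsupp.single t (1 : ℤ)) t := fun t => by
    rw [cone, Finsupp.linearCombination_single, one_smul]
  simp only [key]
  have h := cubeDiff_cubeHtpy v (fun t => Finsupp.single t (1 : ℤ)) s
  rw [cubeDiff] at h
  rw [h]
  simp only [cubeHtpy]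
  split_ifs with hv
  · simp
  · rw [map_smul, boundary_single, sub_sub_cancel]
    rfl

theorem cone_mem_chains {τ : Finset V} {v : V} (hv : v ∈ τ) {p : ℤ} {c : Finset V →₀ ℤ}
    (hc : c ∈ (simplex τ).chains p) : cone v c ∈ (simplex τ).chains (p + 1) := by
  rw [chains, Finsupp.supported_eq_span_single] at hc
  suffices h : Submodule.span ℤ _ ≤ ((simplex τ).chains (p + 1)).comap (cone v) from h hc
  rw [Submodule.span_le]
  rintro _ ⟨s, ⟨hs, hcard⟩, rfl⟩
  simp only [Submodule.comap_coe, Set.mem_preimage, SetLike.mem_coe, cone,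
    Finsupp.linearCombination_single, one_smul, cubeHtpy]
  split_ifs with h
  · exact Submodule.zero_mem _
  · refine Submodule.smul_mem _ _ (Finsupp.single_mem_supported ℤ _ ⟨?_, ?_⟩)
    · exact Finset.insert_subset hv hs
    · rw [Finset.card_insert_of_notMem h]
      push_cast
      omega

theorem chains_eq_bot_of_lt {V : Type*} (K : SimplicialCx V) {p : ℤ} (hp : p < -1) : K.chains p = ⊥ := by
  rw [chains, ← Finsupp.supported_empty]
  congr 1
  ext s
  simp only [Set.mem_ofPred_eq, Set.mem_empty_iff_false, iff_false]
  omega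

/-- Cone off from a vertex of τ. The bound on p is needed for τ = ∅, where degree -1 carries a ℤ;
that ℤ is the source of the class in degree p = 0. -/
theorem cycles_simplex_le (τ : Finset V) {p : ℤ} (hp : 0 ≤ p) :
    (simplex τ).cycles p ≤ (simplex τ).boundaries p := by
  intro z hz
  rcases τ.eq_empty_or_nonempty with rfl | ⟨v, hv⟩
  · suffices h : (simplex (∅ : Finset V)).chains p = ⊥ by
      have hz' := hz.1
      rw [h] at hz'
      rw [(Submodule.mem_bot ℤ).1 hz']
      exact Submodule.zero_mem _
    rw [chains, ← Finsupp.supported_empty]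
    congr 1
    ext s
    simp only [Set.mem_ofPred_eq, Set.mem_empty_iff_false, iff_false, not_and]
    intro hs
    rw [Finset.subset_empty.1 hs]
    simp only [Finset.card_empty]
    omega
  · refine ⟨cone v z, cone_mem_chains hv hz.1, ?_⟩
    rw [boundary_cone, LinearMap.mem_ker.1 hz.2, map_zero, sub_zero]

theorem boundary_mem_chains {K : SimplicialCx V} {p : ℤ} {c : Finset V →₀ ℤ}
    (hc : c ∈ K.chains (p + 1)) : boundary V c ∈ K.chains p :=
  (boundaries_le_cycles K p ⟨c, hc, rfl⟩).1

end Simplex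


/-! ### Mayer–Vietoris for two complexes meeting in a simplex. -/

section Union

variable {V : Type*} {K K₁ K₂ : SimplicialCx V} {τ : Finset V}

theorem chains_union (hu : K.faces = K₁.faces ∪ K₂.faces) (p : ℤ) :
    K.chains p = K₁.chains p ⊔ K₂.chains p := by
  rw [chains, chains, chains, ← Finsupp.supported_union, hu]
  congr 1
  ext s
  simp only [Set.mem_ofPred_eq, Set.mem_union, or_and_right]

theorem chains_inter (hi : K₁.faces ∩ K₂.faces = (simplex τ).faces) (p : ℤ) :
    K₁.chains p ⊓ K₂.chains p = (simplex τ).chains p := by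
  rw [chains, chains, chains, ← Finsupp.supported_inter, ← hi]
  congr 1
  ext s
  simp only [Set.mem_ofPred_eq, Set.mem_inter_iff]
  tauto

theorem full_union (hu : K.faces = K₁.faces ∪ K₂.faces) (J : Finset V) :
    (K.full J).faces = (K₁.full J).faces ∪ (K₂.full J).faces := by
  ext s
  simp only [full, hu, Set.mem_ofPred_eq, Set.mem_union, or_and_right]

theorem full_inter [DecidableEq V] (hi : K₁.faces ∩ K₂.faces = (simplex τ).faces) (J : Finset V) :
    (K₁.full J).faces ∩ (K₂.full J).faces = (simplex (τ ∩ J)).faces := by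
  ext s
  have h : s ∈ K₁.faces ∧ s ∈ K₂.faces ↔ s ⊆ τ := Set.ext_iff.1 hi s
  simp only [full, simplex, Set.mem_ofPred_eq, Set.mem_inter_iff, Finset.subset_inter_iff, ← h]
  tauto

theorem left_subset (hu : K.faces = K₁.faces ∪ K₂.faces) : K₁.faces ⊆ K.faces :=
  hu ▸ Set.subset_union_left

theorem right_subset (hu : K.faces = K₁.faces ∪ K₂.faces) : K₂.faces ⊆ K.faces :=
  hu ▸ Set.subset_union_right

variable [LinearOrder V]

theorem simplex_cycle_mem_boundaries (hi : K₁.faces ∩ K₂.faces = (simplex τ).faces) {p : ℤ}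
    (hp : 0 ≤ p) {z : Finset V →₀ ℤ} (h₁ : z ∈ K₁.chains p) (h₂ : z ∈ K₂.chains p)
    (hz : boundary V z = 0) :
    ∃ e, e ∈ K₁.chains (p + 1) ∧ e ∈ K₂.chains (p + 1) ∧ boundary V e = z := by
  have h : z ∈ (simplex τ).cycles p := ⟨chains_inter hi p ▸ ⟨h₁, h₂⟩, hz⟩
  obtain ⟨e, he, rfl⟩ := cycles_simplex_le τ hp h
  rw [SetLike.mem_coe, ← chains_inter hi] at he
  exact ⟨e, he.1, he.2, rfl⟩

/-- Injectivity in Mayer–Vietoris: a₁ - ∂b₁ = ∂b₂ - a₂ is a cycle of the common simplex, and a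
filling e there corrects both b₁ and b₂. -/
theorem mem_boundaries_of_add (hu : K.faces = K₁.faces ∪ K₂.faces)
    (hi : K₁.faces ∩ K₂.faces = (simplex τ).faces) {p : ℤ} (hp : 0 ≤ p) {a₁ a₂ : Finset V →₀ ℤ}
    (h₁ : a₁ ∈ K₁.cycles p) (h₂ : a₂ ∈ K₂.cycles p) (h : a₁ + a₂ ∈ K.boundaries p) :
    a₁ ∈ K₁.boundaries p ∧ a₂ ∈ K₂.boundaries p := by
  obtain ⟨b, hb, hba⟩ := h
  rw [SetLike.mem_coe, chains_union hu] at hb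
  obtain ⟨b₁, hb₁, b₂, hb₂, rfl⟩ := Submodule.mem_sup.1 hb
  rw [map_add] at hba
  have hd : a₁ - boundary V b₁ = boundary V b₂ - a₂ := by
    rw [sub_eq_sub_iff_add_eq_add, ← hba, add_comm]
  obtain ⟨e, he₁, he₂, hez⟩ := simplex_cycle_mem_boundaries hi hp
    (Submodule.sub_mem _ h₁.1 (boundary_mem_chains hb₁))
    (hd ▸ Submodule.sub_mem _ (boundary_mem_chains hb₂) h₂.1)
    (by rw [map_sub, boundary_boundary, LinearMap.mem_ker.1 h₁.2, sub_zero])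
  refine ⟨⟨b₁ + e, Submodule.add_mem _ hb₁ he₁, ?_⟩, ⟨b₂ - e, Submodule.sub_mem _ hb₂ he₂, ?_⟩⟩
  · rw [map_add, hez, add_sub_cancel]
  · rw [map_sub, hez, hd, sub_sub_cancel]

/-- Surjectivity in Mayer–Vietoris: ∂a₁ = -∂a₂ is a cycle of the common simplex in degree p - 1 ≥ 0,
so it can be filled there and moved across. -/
theorem exists_cycle_add_cycle (hu : K.faces = K₁.faces ∪ K₂.faces)
    (hi : K₁.faces ∩ K₂.faces = (simplex τ).faces) {p : ℤ} (hp : 1 ≤ p) {a : Finset V →₀ ℤ}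
    (ha : a ∈ K.cycles p) : ∃ a₁ ∈ K₁.cycles p, ∃ a₂ ∈ K₂.cycles p, a₁ + a₂ = a := by
  obtain ⟨hc, ha⟩ := ha
  rw [chains_union hu] at hc
  obtain ⟨a₁, h₁, a₂, h₂, rfl⟩ := Submodule.mem_sup.1 hc
  rw [SetLike.mem_coe, LinearMap.mem_ker, map_add] at ha
  obtain ⟨q, rfl⟩ : ∃ q, p = q + 1 := ⟨p - 1, by ring⟩
  have hd : boundary V a₁ = -boundary V a₂ := eq_neg_of_add_eq_zero_left ha
  obtain ⟨e, he₁, he₂, hez⟩ := simplex_cycle_mem_boundaries hi (by omega : 0 ≤ q)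
    (boundary_mem_chains h₁) (hd ▸ Submodule.neg_mem _ (boundary_mem_chains h₂))
    (boundary_boundary a₁)
  refine ⟨a₁ - e, ⟨Submodule.sub_mem _ h₁ he₁, ?_⟩, a₂ + e, ⟨Submodule.add_mem _ h₂ he₂, ?_⟩, ?_⟩
  · rw [SetLike.mem_coe, LinearMap.mem_ker, map_sub, hez, sub_self]
  · rw [SetLike.mem_coe, LinearMap.mem_ker, map_add, hez, hd, add_neg_cancel]
  · abel

end Union

/-! ### Cocycles as families of cycles; contraction along ghost vertices. -/

section Cochains

variable {V : Type*} [LinearOrder V]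

/-- `a` is a family of cycles whose classes form a cocycle of the double complex. -/
def IsCocycle (K : SimplicialCx V) (p : ℤ) (a : Finset V → Finset V →₀ ℤ) : Prop :=
  (∀ J, a J ∈ (K.full J).cycles p) ∧ ∀ J, cubeDiff a J ∈ (K.full J).boundaries p

/-- `a` is a family of cycles whose classes form a coboundary of the double complex. -/
def IsCoboundary (K : SimplicialCx V) (p : ℤ) (a : Finset V → Finset V →₀ ℤ) : Prop :=
  ∃ b : Finset V → Finset V →₀ ℤ, (∀ J, b J ∈ (K.full J).cycles p) ∧
    ∀ J, a J - cubeDiff b J ∈ (K.full J).boundaries p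

theorem cubeDiff_mem_cycles {K : SimplicialCx V} {p : ℤ} {a : Finset V → Finset V →₀ ℤ}
    (ha : ∀ J, a J ∈ (K.full J).cycles p) (J : Finset V) :
    cubeDiff a J ∈ (K.full J).cycles p :=
  Submodule.sum_mem _ fun x _ => Submodule.smul_mem _ _
    (cycles_mono (K.full_mono (J.erase_subset x)) p (ha _))

theorem full_insert_of_isGhost {K : SimplicialCx V} {x : V} (hx : K.IsGhost x) (J : Finset V) :
    K.full (insert x J) = K.full J := by
  ext s
  refine ⟨fun h => ⟨h.1, fun y hy => ?_⟩, fun h => ⟨h.1, h.2.trans (Finset.subset_insert x J)⟩⟩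
  rcases Finset.mem_insert.1 (h.2 hy) with rfl | hJ
  · exact absurd (K.down_closed s h.1 _ (Finset.singleton_subset_iff.2 hy)) hx
  · exact hJ

/-- The cube homotopy in direction x takes values in the right groups, because K_{J ∪ {x}} = K_J. -/
theorem IsCocycle.isCoboundary_of_isGhost {K : SimplicialCx V} {p : ℤ}
    {a : Finset V → Finset V →₀ ℤ} (ha : K.IsCocycle p a) {x : V} (hx : K.IsGhost x) :
    K.IsCoboundary p a := by
  refine ⟨cubeHtpy x a, fun J => ?_, fun J => ?_⟩
  · unfold cubeHtpy
    split_ifs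
    · exact Submodule.zero_mem _
    · exact Submodule.smul_mem _ _ (full_insert_of_isGhost hx J ▸ ha.1 (insert x J))
  · rw [cubeDiff_cubeHtpy, sub_sub_cancel]
    unfold cubeHtpy
    split_ifs
    · exact Submodule.zero_mem _
    · exact Submodule.smul_mem _ _ (full_insert_of_isGhost hx J ▸ ha.2 (insert x J))

variable {K K₁ K₂ : SimplicialCx V} {τ : Finset V}

theorem IsCocycle.isCoboundary_of_add (hu : K.faces = K₁.faces ∪ K₂.faces)
    (hi : K₁.faces ∩ K₂.faces = (simplex τ).faces) {x₁ x₂ : V} (hx₁ : K₁.IsGhost x₁)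
    (hx₂ : K₂.IsGhost x₂) {p : ℤ} (hp : 0 ≤ p) {a : Finset V → Finset V →₀ ℤ}
    (ha : K.IsCocycle p a)
    (h : ∀ J, ∃ a₁ ∈ (K₁.full J).cycles p, ∃ a₂ ∈ (K₂.full J).cycles p, a₁ + a₂ = a J) :
    K.IsCoboundary p a := by
  -- The splittings are chosen independently for each J; injectivity of Mayer–Vietoris still makes
  -- both halves cocycles.
  choose a₁ h₁ a₂ h₂ e using h
  have hd : ∀ J, cubeDiff a J = cubeDiff a₁ J + cubeDiff a₂ J := fun J => by
    rw [← cubeDiff_add]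
    exact cubeDiff_congr fun x _ => (e _).symm
  have hb : ∀ J, cubeDiff a₁ J ∈ (K₁.full J).boundaries p ∧
      cubeDiff a₂ J ∈ (K₂.full J).boundaries p := fun J =>
    mem_boundaries_of_add (full_union hu J) (full_inter hi J) hp (cubeDiff_mem_cycles h₁ J)
      (cubeDiff_mem_cycles h₂ J) (hd J ▸ ha.2 J)
  obtain ⟨b₁, hb₁, hab₁⟩ :=
    IsCocycle.isCoboundary_of_isGhost ⟨h₁, fun J => (hb J).1⟩ hx₁
  obtain ⟨b₂, hb₂, hab₂⟩ :=
    IsCocycle.isCoboundary_of_isGhost ⟨h₂, fun J => (hb J).2⟩ hx₂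
  have s₁ := fun J => left_subset (full_union hu J)
  have s₂ := fun J => right_subset (full_union hu J)
  refine ⟨fun J => b₁ J + b₂ J, fun J =>
    Submodule.add_mem _ (cycles_mono (s₁ J) p (hb₁ J)) (cycles_mono (s₂ J) p (hb₂ J)), fun J => ?_⟩
  rw [cubeDiff_add, ← e J, add_sub_add_comm]
  exact Submodule.add_mem _ (boundaries_mono (s₁ J) p (hab₁ J)) (boundaries_mono (s₂ J) p (hab₂ J))

end Cochains


/-! ### Degree zero: the vertex sum as connecting homomorphism. -/

section VertexSum

variable {V : Type*}

open Classical in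
/-- The sum of the coefficients of a chain at the vertices of `L`. -/
noncomputable def vertexSum (L : SimplicialCx V) : (Finset V →₀ ℤ) →ₗ[ℤ] ℤ :=
  Finsupp.linearCombination ℤ fun s => if s ∈ L.faces ∧ s.card = 1 then 1 else 0

theorem vertexSum_single {L : SimplicialCx V} {v : V} (hv : {v} ∈ L.faces) :
    vertexSum L (Finsupp.single {v} 1) = 1 := by
  rw [vertexSum, Finsupp.linearCombination_single, if_pos ⟨hv, Finset.card_singleton v⟩, smul_eq_mul,
    mul_one]

theorem vertexSum_single_of_isGhost {L : SimplicialCx V} {v : V} (hv : L.IsGhost v) :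
    vertexSum L (Finsupp.single {v} 1) = 0 := by
  rw [vertexSum, Finsupp.linearCombination_single, if_neg fun h => hv h.1, smul_zero]

theorem chains_zero_induction {L : SimplicialCx V} {N : Type*} [AddCommGroup N]
    {f g : (Finset V →₀ ℤ) →ₗ[ℤ] N}
    (h : ∀ v, {v} ∈ L.faces → f (Finsupp.single {v} 1) = g (Finsupp.single {v} 1))
    {c : Finset V →₀ ℤ} (hc : c ∈ L.chains 0) : f c = g c := by
  rw [chains, Finsupp.supported_eq_span_single] at hc
  refine LinearMap.eqOn_span ?_ hc
  rintro _ ⟨s, ⟨hs, hcard⟩, rfl⟩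
  obtain ⟨v, rfl⟩ := Finset.card_eq_one.1 (by omega : s.card = 1)
  exact h v hs

theorem vertexSum_eq_zero {K L : SimplicialCx V} (h : ∀ v, {v} ∈ K.faces → L.IsGhost v)
    {c : Finset V →₀ ℤ} (hc : c ∈ K.chains 0) : vertexSum L c = 0 :=
  chains_zero_induction (g := 0) (fun v hv => vertexSum_single_of_isGhost (h v hv)) hc

variable [LinearOrder V]

theorem boundary_singleton (v : V) : boundary V (Finsupp.single {v} 1) = Finsupp.single ∅ 1 := by
  rw [boundary_single, Finset.sum_singleton]
  have h : ({v} : Finset V).erase v = ∅ := by simp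
  rw [h, ← sgn_erase_self, h]
  simp [sgn]

theorem vertexSum_eq_boundary {K L : SimplicialCx V} (h : ∀ v, {v} ∈ K.faces → {v} ∈ L.faces)
    {c : Finset V →₀ ℤ} (hc : c ∈ K.chains 0) : vertexSum L c = boundary V c ∅ := by
  refine chains_zero_induction (g := Finsupp.lapply ∅ ∘ₗ boundary V) (fun v hv => ?_) hc
  rw [vertexSum_single (h v hv), LinearMap.comp_apply, boundary_singleton, Finsupp.lapply_apply,
    Finsupp.single_eq_same]

theorem boundary_mem_chains_neg_one {K : SimplicialCx V} {c : Finset V →₀ ℤ}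
    (hc : c ∈ K.chains 0) : boundary V c ∈ K.chains (-1) :=
  boundary_mem_chains (p := -1) hc

theorem eq_zero_of_mem_chains_neg_one {V : Type*} {K : SimplicialCx V} {c : Finset V →₀ ℤ}
    (hc : c ∈ K.chains (-1)) (h : c ∅ = 0) : c = 0 := by
  ext s
  by_contra hs
  have := (hc (Finsupp.mem_support_iff.2 hs)).2
  have hs' : s = ∅ := Finset.card_eq_zero.1 (by omega)
  exact hs (hs' ▸ h)

variable {K K₁ K₂ : SimplicialCx V} {τ : Finset V}

/-- A vertex common to K₁ and K₂ lies in τ, which J avoids. -/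
theorem vertexSum_left_eq_zero {V : Type*} {K₁ K₂ : SimplicialCx V} {τ : Finset V}
    (hi : K₁.faces ∩ K₂.faces = (simplex τ).faces) {J : Finset V}
    (hJ : Disjoint J τ) {c : Finset V →₀ ℤ} (hc : c ∈ (K₂.full J).chains 0) :
    vertexSum K₁ c = 0 := by
  refine vertexSum_eq_zero (K := K₂.full J) (fun v hv h => ?_) hc
  have hτ : ({v} : Finset V) ⊆ τ := (Set.ext_iff.1 hi {v}).1 ⟨h, hv.1⟩
  exact Finset.disjoint_left.1 hJ (Finset.singleton_subset_iff.1 hv.2)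
    (Finset.singleton_subset_iff.1 hτ)

/-- Identifies `vertexSum K₁` with the connecting homomorphism: it is the augmentation of the
K₁-half of the chain. -/
theorem exists_chain_add_chain_disjoint (hu : K.faces = K₁.faces ∪ K₂.faces)
    (hi : K₁.faces ∩ K₂.faces = (simplex τ).faces) {J : Finset V} (hJ : Disjoint J τ)
    {c : Finset V →₀ ℤ} (hc : c ∈ (K.full J).chains 0) :
    ∃ c₁ ∈ (K₁.full J).chains 0, ∃ c₂ ∈ (K₂.full J).chains 0, c₁ + c₂ = c ∧
      vertexSum K₁ c = boundary V c₁ ∅ := by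
  rw [chains_union (full_union hu J)] at hc
  obtain ⟨c₁, h₁, c₂, h₂, rfl⟩ := Submodule.mem_sup.1 hc
  refine ⟨c₁, h₁, c₂, h₂, rfl, ?_⟩
  rw [map_add, vertexSum_eq_boundary (K := K₁.full J) (fun v hv => hv.1) h₁,
    vertexSum_left_eq_zero hi hJ h₂, add_zero]

theorem vertexSum_of_mem_boundaries (hu : K.faces = K₁.faces ∪ K₂.faces)
    (hi : K₁.faces ∩ K₂.faces = (simplex τ).faces) {J : Finset V} (hJ : Disjoint J τ)
    {c : Finset V →₀ ℤ} (hc : c ∈ (K.full J).boundaries 0) : vertexSum K₁ c = 0 := by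
  obtain ⟨e, he, rfl⟩ := hc
  rw [SetLike.mem_coe, chains_union (full_union hu J)] at he
  obtain ⟨e₁, h₁, e₂, h₂, rfl⟩ := Submodule.mem_sup.1 he
  rw [map_add, map_add,
    vertexSum_eq_boundary (K := K₁.full J) (fun v hv => hv.1) (boundary_mem_chains h₁),
    boundary_boundary, Finsupp.zero_apply, zero_add,
    vertexSum_left_eq_zero hi hJ (boundary_mem_chains h₂)]

/-- The vertex sum is the only obstruction to splitting, and only for J disjoint from τ; otherwise a
vertex of J ∩ τ can absorb the augmentation. -/
theorem exists_cycle_add_cycle_zero (hu : K.faces = K₁.faces ∪ K₂.faces)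
    (hi : K₁.faces ∩ K₂.faces = (simplex τ).faces) {J : Finset V} {a : Finset V →₀ ℤ}
    (ha : a ∈ (K.full J).cycles 0) (hq : Disjoint J τ → vertexSum K₁ a = 0) :
    ∃ a₁ ∈ (K₁.full J).cycles 0, ∃ a₂ ∈ (K₂.full J).cycles 0, a₁ + a₂ = a := by
  obtain ⟨hc, hd⟩ := ha
  rw [SetLike.mem_coe, LinearMap.mem_ker] at hd
  by_cases hJ : Disjoint J τ
  · obtain ⟨a₁, h₁, a₂, h₂, rfl, h⟩ := exists_chain_add_chain_disjoint hu hi hJ hc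
    have hz : boundary V a₁ = 0 :=
      eq_zero_of_mem_chains_neg_one (boundary_mem_chains_neg_one h₁) (h ▸ hq hJ)
    rw [map_add, hz, zero_add] at hd
    exact ⟨a₁, ⟨h₁, hz⟩, a₂, ⟨h₂, hd⟩, rfl⟩
  · rw [chains_union (full_union hu J)] at hc
    obtain ⟨a₁, h₁, a₂, h₂, rfl⟩ := Submodule.mem_sup.1 hc
    obtain ⟨v, hvJ, hvτ⟩ := Finset.not_disjoint_iff.1 hJ
    have hvi : ({v} : Finset V) ∈ K₁.faces ∩ K₂.faces := by
      rw [hi]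
      exact Finset.singleton_subset_iff.2 hvτ
    have hvJ' := Finset.singleton_subset_iff.2 hvJ
    have hcard : ((({v} : Finset V).card : ℕ) : ℤ) = 0 + 1 := by simp
    have hv₁ : (Finsupp.single {v} 1 : Finset V →₀ ℤ) ∈ (K₁.full J).chains 0 :=
      Finsupp.single_mem_supported ℤ _ ⟨⟨hvi.1, hvJ'⟩, hcard⟩
    have hv₂ : (Finsupp.single {v} 1 : Finset V →₀ ℤ) ∈ (K₂.full J).chains 0 :=
      Finsupp.single_mem_supported ℤ _ ⟨⟨hvi.2, hvJ'⟩, hcard⟩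
    -- w is the multiple of the common vertex v with the augmentation of a₁.
    obtain ⟨w, hw₁, hw₂, hw⟩ : ∃ w ∈ (K₁.full J).chains 0, w ∈ (K₂.full J).chains 0 ∧
        boundary V (a₁ - w) = 0 := by
      refine ⟨boundary V a₁ ∅ • Finsupp.single {v} 1, Submodule.smul_mem _ _ hv₁,
        Submodule.smul_mem _ _ hv₂, eq_zero_of_mem_chains_neg_one (boundary_mem_chains_neg_one
          (Submodule.sub_mem _ h₁ (Submodule.smul_mem _ _ hv₁))) ?_⟩
      rw [map_sub, map_smul, boundary_singleton]
      simp
    refine ⟨a₁ - w, ⟨Submodule.sub_mem _ h₁ hw₁, hw⟩, a₂ + w,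
      ⟨Submodule.add_mem _ h₂ hw₂, ?_⟩, sub_add_add_cancel _ _ _⟩
    rw [map_add] at hd
    rw [map_sub, sub_eq_zero] at hw
    rw [SetLike.mem_coe, LinearMap.mem_ker, map_add, ← hw, add_comm, hd]

theorem vertexSum_of_subset_right {J : Finset V}
    (hJ : ∀ x ∈ J, K₁.IsGhost x) {a : Finset V →₀ ℤ} (ha : a ∈ (K.full J).cycles 0) :
    vertexSum K₁ a = 0 :=
  vertexSum_eq_zero (K := K.full J) (fun _ hv => hJ _ (Finset.singleton_subset_iff.1 hv.2)) ha.1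

theorem vertexSum_of_subset_left {J : Finset V}
    (hJ : ∀ x ∈ J, {x} ∈ K₁.faces) {a : Finset V →₀ ℤ} (ha : a ∈ (K.full J).cycles 0) :
    vertexSum K₁ a = 0 := by
  rw [vertexSum_eq_boundary (K := K.full J) (fun _ hv => hJ _ (Finset.singleton_subset_iff.1 hv.2)) ha.1,
    LinearMap.mem_ker.1 ha.2, Finsupp.zero_apply]

/-- A cocycle on the cube of subsets of a disjoint union `A ∪ B` that vanishes on the subsets of
`A` and on the subsets of `B`, and also on a two-element subset `{a, b}`, is the differential of
a function that vanishes on the subsets of `A` and on those of `B`. -/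
theorem exists_cubeDiff_eq {M : Type*} [AddCommGroup M] {A B : V → Prop}
    (hAB : ∀ x, A x → ¬B x) {a b : V} (ha : A a) (hb : B b) {f : Finset V → M}
    (hf : ∀ J : Finset V, (∀ x ∈ J, A x ∨ B x) → cubeDiff f J = 0)
    (hfA : ∀ J : Finset V, (∀ x ∈ J, A x) → f J = 0)
    (hfB : ∀ J : Finset V, (∀ x ∈ J, B x) → f J = 0) (hab : f {a, b} = 0) :
    ∃ g : Finset V → M, (∀ J : Finset V, (∀ x ∈ J, A x) → g J = 0) ∧
      (∀ J : Finset V, (∀ x ∈ J, B x) → g J = 0) ∧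
      ∀ J : Finset V, (∀ x ∈ J, A x ∨ B x) → cubeDiff g J = f J := by
  classical
  have hins : ∀ {P : V → Prop} {x : V} {J : Finset V}, P x → (∀ y ∈ J, P y) →
      ∀ y ∈ insert x J, P y := fun hx hJ => (Finset.forall_mem_insert ..).2 ⟨hx, hJ⟩
  have her : ∀ {P : V → Prop} {J : Finset V} (x : V), (∀ y ∈ J, P y) →
      ∀ y ∈ J.erase x, P y := fun x hJ y hy => hJ y (Finset.mem_of_mem_erase hy)
  -- `cubeHtpy a f` is a primitive of f that already vanishes on subsets of A, but perhaps not on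
  -- subsets of B.
  have hh : ∀ J : Finset V, (∀ x ∈ J, A x ∨ B x) → cubeDiff (cubeHtpy a f) J = f J := by
    intro J hJ
    rw [cubeDiff_cubeHtpy, cubeHtpy, hf _ (hins (Or.inl ha) hJ), smul_zero, ite_self, sub_zero]
  -- On subsets of B that primitive is closed, so it is the differential of v there; subtracting
  -- `cubeDiff v` everywhere repairs it.
  let v : Finset V → M := fun J => if ∀ x ∈ J, B x then cubeHtpy b (cubeHtpy a f) J else 0
  have hv : ∀ J : Finset V, (∀ x ∈ J, B x) → cubeDiff v J = cubeHtpy a f J := by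
    intro J hJ
    rw [cubeDiff_congr (g := cubeHtpy b (cubeHtpy a f)) fun x _ => if_pos (her x hJ),
      cubeDiff_cubeHtpy]
    have h : cubeHtpy b (cubeDiff (cubeHtpy a f)) J = 0 := by
      rw [cubeHtpy, hh _ fun x hx => Or.inr (hins hb hJ x hx), hfB _ (hins hb hJ), smul_zero,
        ite_self]
    rw [h, sub_zero]
  -- v ∅ is f {a, b} up to sign. Its vanishing keeps the correction zero on singletons of A.
  have hv0 : v ∅ = 0 := by
    have hne : a ∉ ({b} : Finset V) := fun h => hAB a ha (Finset.mem_singleton.1 h ▸ hb)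
    simp [v, cubeHtpy, hab]
  refine ⟨fun J => cubeHtpy a f J - cubeDiff v J, fun J hJ => ?_, fun J hJ => ?_, fun J hJ => ?_⟩
  · have h1 : cubeHtpy a f J = 0 := by
      rw [cubeHtpy, hfA _ (hins ha hJ), smul_zero, ite_self]
    have h2 : cubeDiff v J = cubeDiff 0 J := cubeDiff_congr fun x _ => by
      rcases (J.erase x).eq_empty_or_nonempty with h | ⟨y, hy⟩
      · rw [h, hv0, Pi.zero_apply]
      · exact if_neg fun h => hAB y (her x hJ y hy) (h y hy)
    simp only [h1, h2]
    simp [cubeDiff]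
  · simp only [hv J hJ, sub_self]
  · rw [cubeDiff_sub, hh J hJ]
    exact (congrArg _ (cubeDiff_cubeDiff v J)).trans (sub_zero _)

end VertexSum

/-! ### Cocycles of a face sum. -/

section FaceSum

variable {V : Type*} [LinearOrder V] {K K₁ K₂ : SimplicialCx V} {τ : Finset V}

theorem IsFaceSum.symm {V : Type*} {K K₁ K₂ : SimplicialCx V} {τ : Finset V}
    (h : IsFaceSum K K₁ K₂ τ) : IsFaceSum K K₂ K₁ τ :=
  ⟨h.union_eq.trans (Set.union_comm _ _), (Set.inter_comm _ _).trans h.inter_eq, h.proper_right,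
    h.proper_left⟩

/-- Properness yields a face of K₁ not inside τ; any of its vertices outside τ cannot belong to K₂.
-/
theorem IsFaceSum.exists_vertex_left {V : Type*} {K K₁ K₂ : SimplicialCx V} {τ : Finset V}
    (h : IsFaceSum K K₁ K₂ τ) : ∃ x, {x} ∈ K₁.faces ∧ K₂.IsGhost x := by
  have hsub : ¬K₁.faces ⊆ (simplex τ).faces := fun hs =>
    h.proper_left.2 <| SimplicialCx.ext <| hs.antisymm fun t ht =>
      K₁.down_closed τ h.proper_left.1 t ht
  obtain ⟨s, hs, hsτ⟩ := Set.not_subset.1 hsub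
  obtain ⟨x, hx, hxτ⟩ := Finset.not_subset.1 hsτ
  have hx₁ := K₁.down_closed s hs _ (Finset.singleton_subset_iff.2 hx)
  exact ⟨x, hx₁, fun hx₂ => hxτ <| Finset.singleton_subset_iff.1 <|
    (Set.ext_iff.1 h.inter_eq {x}).1 ⟨hx₁, hx₂⟩⟩

theorem IsFaceSum.isCoboundary_of_one_le (h : IsFaceSum K K₁ K₂ τ) {p : ℤ} (hp : 1 ≤ p)
    {a : Finset V → Finset V →₀ ℤ} (ha : K.IsCocycle p a) : K.IsCoboundary p a := by
  obtain ⟨x₁, -, hx₁⟩ := h.symm.exists_vertex_left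
  obtain ⟨x₂, -, hx₂⟩ := h.exists_vertex_left
  exact ha.isCoboundary_of_add h.union_eq h.inter_eq hx₁ hx₂ (by omega) fun J =>
    exists_cycle_add_cycle (full_union h.union_eq J) (full_inter h.inter_eq J) hp (ha.1 J)

theorem single_sub_single_mem_cycles {x y : V} (hx : {x} ∈ K.faces) (hy : {y} ∈ K.faces) :
    (Finsupp.single {x} 1 - Finsupp.single {y} 1 : Finset V →₀ ℤ) ∈ K.cycles 0 := by
  refine ⟨Submodule.sub_mem _ (Finsupp.single_mem_supported ℤ _ ⟨hx, by simp⟩)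
    (Finsupp.single_mem_supported ℤ _ ⟨hy, by simp⟩), ?_⟩
  rw [SetLike.mem_coe, LinearMap.mem_ker, map_sub, boundary_singleton, boundary_singleton, sub_self]

/-- Away from `τ`, every integer is the vertex sum of a `0`-cycle of a full subcomplex that meets
both summands. -/
theorem exists_cycle_vertexSum_eq {J : Finset V} {x y : V} (hK : ∀ x, {x} ∈ K.faces)
    (hx : x ∈ J) (hy : y ∈ J) (hx₁ : {x} ∈ K₁.faces) (hy₁ : K₁.IsGhost y) (n : ℤ) :
    ∃ b ∈ (K.full J).cycles 0, vertexSum K₁ b = n := by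
  refine ⟨n • (Finsupp.single {x} 1 - Finsupp.single {y} 1), Submodule.smul_mem _ _
    (single_sub_single_mem_cycles (K := K.full J) ⟨hK x, Finset.singleton_subset_iff.2 hx⟩
      ⟨hK y, Finset.singleton_subset_iff.2 hy⟩), ?_⟩
  rw [map_smul, map_sub, vertexSum_single hx₁, vertexSum_single_of_isGhost hy₁, sub_zero,
    smul_eq_mul, mul_one]

/-- Away from τ the vertex sums form a cube cocycle vanishing on one-sided subsets. The value on
{x₁, x₂} is its only obstruction to being a differential of such functions; a primitive lifts to
cycles, and subtracting its differential leaves a splittable cocycle. -/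
theorem IsFaceSum.isCoboundary_of_vertexSum (h : IsFaceSum K K₁ K₂ τ) (hK : ∀ x, {x} ∈ K.faces)
    {x₁ x₂ : V} (hx₁ : K₂.IsGhost x₁) (hx₂ : K₁.IsGhost x₂) {a : Finset V → Finset V →₀ ℤ}
    (ha : K.IsCocycle 0 a) (hq : vertexSum K₁ (a {x₁, x₂}) = 0) : K.IsCoboundary 0 a := by
  have hmem : ∀ x, {x} ∈ K₁.faces ∨ {x} ∈ K₂.faces := fun x =>
    (Set.ext_iff.1 h.union_eq {x}).1 (hK x)
  have hτ : ∀ x, {x} ∈ K₁.faces ∧ {x} ∈ K₂.faces ↔ x ∈ τ := fun x =>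
    (Set.ext_iff.1 h.inter_eq {x}).trans Finset.singleton_subset_iff
  have hdisj : ∀ J : Finset V, Disjoint J τ ↔ ∀ x ∈ J, K₂.IsGhost x ∨ K₁.IsGhost x := fun J => by
    simp only [Finset.disjoint_left, ← hτ, IsGhost, not_and_or, or_comm]
  have hl : ∀ J : Finset V, (∀ x ∈ J, K₂.IsGhost x) → ∀ x ∈ J, {x} ∈ K₁.faces :=
    fun J hJ x hx => (hmem x).resolve_right (hJ x hx)
  obtain ⟨g, hg₁, hg₂, hg⟩ := exists_cubeDiff_eq (A := K₂.IsGhost) (B := K₁.IsGhost)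
    (f := fun J => vertexSum K₁ (a J))
    (fun x h₂ h₁ => (hmem x).elim h₁ h₂) hx₁ hx₂
    (fun J hJ => by
      rw [map_cubeDiff]
      exact vertexSum_of_mem_boundaries h.union_eq h.inter_eq ((hdisj J).2 hJ) (ha.2 J))
    (fun J hJ => vertexSum_of_subset_left (hl J hJ) (ha.1 J))
    (fun J hJ => vertexSum_of_subset_right hJ (ha.1 J)) hq
  -- Lift g to cycles: zero on one-sided J, where g vanishes, and on J meeting τ, where nothing is
  -- required.
  have hb : ∀ J : Finset V, ∃ b ∈ (K.full J).cycles 0, Disjoint J τ → vertexSum K₁ b = g J := by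
    intro J
    by_cases h₁ : ∀ x ∈ J, K₁.IsGhost x
    · exact ⟨0, Submodule.zero_mem _, fun _ => by rw [hg₂ J h₁, map_zero]⟩
    by_cases h₂ : ∀ x ∈ J, K₂.IsGhost x
    · exact ⟨0, Submodule.zero_mem _, fun _ => by rw [hg₁ J h₂, map_zero]⟩
    by_cases hJ : Disjoint J τ
    · push Not at h₁ h₂
      obtain ⟨x, hx, hxg⟩ := h₁
      obtain ⟨y, hy, hyg⟩ := h₂
      obtain ⟨b, hb, hbg⟩ := exists_cycle_vertexSum_eq (K₁ := K₁) hK hx hy (not_not.1 hxg)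
        (((hdisj J).1 hJ y hy).resolve_left hyg) (g J)
      exact ⟨b, hb, fun _ => hbg⟩
    · exact ⟨0, Submodule.zero_mem _, fun h => absurd h hJ⟩
  choose b hb hbg using hb
  have ha' : K.IsCocycle 0 fun J => a J - cubeDiff b J := by
    refine ⟨fun J => Submodule.sub_mem _ (ha.1 J) (cubeDiff_mem_cycles hb J), fun J => ?_⟩
    rw [cubeDiff_sub]
    have h0 : cubeDiff (fun J => cubeDiff b J) J = 0 := cubeDiff_cubeDiff b J
    rw [h0, sub_zero]
    exact ha.2 J
  obtain ⟨c, hc, hac⟩ := ha'.isCoboundary_of_add h.union_eq h.inter_eq hx₂ hx₁ le_rfl fun J =>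
    exists_cycle_add_cycle_zero h.union_eq h.inter_eq (ha'.1 J) fun hJ => by
      rw [map_sub, ← map_cubeDiff, ← hg J ((hdisj J).1 hJ), sub_eq_zero]
      exact cubeDiff_congr fun x _ =>
        (hbg _ (Finset.disjoint_of_subset_left (J.erase_subset x) hJ)).symm
  refine ⟨fun J => b J + c J, fun J => Submodule.add_mem _ (hb J) (hc J), fun J => ?_⟩
  rw [cubeDiff_add, ← sub_sub]
  exact hac J

end FaceSum

/-! ### From families of cycles to homology classes. -/

section Quotient

variable {V : Type*} [LinearOrder V] {K : SimplicialCx V} {p : ℤ}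

theorem diff_mk (b : ∀ J : Finset V, (K.full J).cycles p) (J : Finset V) :
    K.diff p (fun J => Submodule.Quotient.mk (b J)) J = ((p - 1).negOnePow : ℤ) •
      Submodule.Quotient.mk ⟨cubeDiff (fun J => (b J : Finset V →₀ ℤ)) J,
        cubeDiff_mem_cycles (fun J => (b J).2) J⟩ := by
  simp only [diff, LinearMap.pi_apply, LinearMap.smul_apply, LinearMap.sum_apply,
    LinearMap.comp_apply, LinearMap.proj_apply]
  congr 1
  have h : (⟨cubeDiff (fun J => (b J : Finset V →₀ ℤ)) J,
        cubeDiff_mem_cycles (fun J => (b J).2) J⟩ : (K.full J).cycles p) =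
      ∑ x ∈ J, sgn x (J.erase x) •
        Submodule.inclusion (cycles_mono (K.full_mono (J.erase_subset x)) p) (b (J.erase x)) := by
    refine Subtype.ext ?_
    simp only [cubeDiff, sgn_erase_self, Submodule.coe_sum, Submodule.coe_smul,
      Submodule.coe_inclusion]
  rw [h, ← Submodule.mkQ_apply, map_sum]
  rfl

theorem mk_eq_zero_iff {J : Finset V} {z : (K.full J).cycles p} :
    (Submodule.Quotient.mk z : (K.full J).RedHomology p) = 0 ↔
      (z : Finset V →₀ ℤ) ∈ (K.full J).boundaries p :=
  Submodule.Quotient.mk_eq_zero _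

/-- The global sign is a unit, so it disappears from the cocycle condition. -/
theorem diff_mk_eq_zero_iff (b : ∀ J : Finset V, (K.full J).cycles p) :
    K.diff p (fun J => Submodule.Quotient.mk (b J)) = 0 ↔
      K.IsCocycle p fun J => (b J : Finset V →₀ ℤ) := by
  rw [funext_iff]
  refine Iff.trans (forall_congr' fun J => ?_) (and_iff_right fun J => (b J).2).symm
  rw [diff_mk, Pi.zero_apply, ← Units.smul_def, smul_eq_zero_iff_eq, mk_eq_zero_iff]

/-- A coboundary of the total complex that is concentrated in degree `l` is the differential of an
element of degree `l - 1`. -/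
theorem exists_diff_eq {l : ℤ} (a : ∀ J : Finset V, (K.full J).cycles p)
    (hl : (fun J => Submodule.Quotient.mk (a J)) ∈ K.CHPart p l)
    (ha : K.IsCoboundary p fun J => (a J : Finset V →₀ ℤ)) :
    ∃ b ∈ K.CHPart p (l - 1), K.diff p b = fun J => Submodule.Quotient.mk (a J) := by
  obtain ⟨b, hb, hab⟩ := ha
  -- Truncate to |J| = l - 1 and insert the global sign, which squares to 1 against that of `diff`.
  let b' : ∀ J : Finset V, (K.full J).cycles p := fun J =>
    if (J.card : ℤ) = l - 1 then ((p - 1).negOnePow : ℤ) • ⟨b J, hb J⟩ else 0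
  have hb' : (fun J => Submodule.Quotient.mk (b' J)) ∈ K.CHPart p (l - 1) := fun J hJ => by
    simp only [b', if_neg hJ, Submodule.Quotient.mk_zero]
  refine ⟨_, hb', funext fun J => ?_⟩
  by_cases hJ : (J.card : ℤ) = l
  · rw [diff_mk, ← Submodule.Quotient.mk_smul, eq_comm, Submodule.Quotient.eq]
    have h : cubeDiff (fun J => (b' J : Finset V →₀ ℤ)) J =
        ((p - 1).negOnePow : ℤ) • cubeDiff b J := by
      rw [cubeDiff, cubeDiff, Finset.smul_sum]
      refine Finset.sum_congr rfl fun x hx => ?_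
      have := Finset.card_erase_add_one hx
      simp only [b']
      rw [if_pos (by omega), Submodule.coe_smul, smul_comm]
    change (a J : Finset V →₀ ℤ) - ((p - 1).negOnePow : ℤ) •
      cubeDiff (fun J => (b' J : Finset V →₀ ℤ)) J ∈ (K.full J).boundaries p
    rw [h, smul_smul, ← Units.val_mul, Int.units_mul_self, Units.val_one, one_smul]
    exact hab J
  · have := diff_mem K p (l - 1) _ hb' J (by omega)
    exact this.trans (hl J hJ).symm

/-- A linear functional identifies the double homology with `ℤ` if it vanishes on coboundaries,
detects them among cocycles, and takes the value one on a cocycle. -/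
theorem nonempty_doubleHomology_addEquiv {l : ℤ} (Ψ : K.CHTotal p →ₗ[ℤ] ℤ)
    (hΨ : ∀ b ∈ K.CHPart p (l - 1), Ψ (K.diff p b) = 0)
    (hker : ∀ c ∈ K.CHPart p l, K.diff p c = 0 → Ψ c = 0 →
      ∃ b ∈ K.CHPart p (l - 1), K.diff p b = c)
    (hsurj : ∃ c ∈ K.CHPart p l, K.diff p c = 0 ∧ Ψ c = 1) :
    Nonempty (K.DoubleHomology p l ≃+ ℤ) := by
  let Ψ' := Ψ.domRestrict (K.CHPart p l ⊓ LinearMap.ker (K.diff p))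
  have hs : Function.Surjective Ψ' := fun n => by
    obtain ⟨c, hc, hd, h1⟩ := hsurj
    refine ⟨n • ⟨c, hc, hd⟩, ?_⟩
    rw [map_smul]
    change n • Ψ c = n
    rw [h1, smul_eq_mul, mul_one]
  have hk : ((K.CHPart p (l - 1)).map (K.diff p)).submoduleOf
      (K.CHPart p l ⊓ LinearMap.ker (K.diff p)) = LinearMap.ker Ψ' := by
    ext ⟨c, hc, hd⟩
    constructor
    · rintro ⟨b, hb, rfl⟩
      exact hΨ b hb
    · intro h
      exact hker c hc hd h
  exact ⟨((Submodule.quotEquivOfEq _ _ hk).trans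
    (Ψ'.quotKerEquivOfSurjective hs)).toAddEquiv⟩

theorem subsingleton_doubleHomology {l : ℤ}
    (h : ∀ c ∈ K.CHPart p l, K.diff p c = 0 → ∃ b ∈ K.CHPart p (l - 1), K.diff p b = c) :
    Subsingleton (K.DoubleHomology p l) := by
  refine Submodule.Quotient.subsingleton_iff.2 (eq_top_iff.2 ?_)
  rintro ⟨c, hc, hd⟩ -
  exact h c hc hd

end Quotient

/-! ### The groups in each degree. -/

section Computation

variable {V : Type*} [LinearOrder V] {K : SimplicialCx V} {p : ℤ}

theorem exists_rep (c : K.CHTotal p) :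
    ∃ a : ∀ J : Finset V, (K.full J).cycles p, (fun J => Submodule.Quotient.mk (a J)) = c := by
  choose a ha using fun J => Submodule.Quotient.mk_surjective _ (c J)
  exact ⟨a, funext ha⟩

/-- The functional on the total complex that evaluates `q` on the component at `J`. -/
noncomputable def evalAt (J : Finset V) (q : (Finset V →₀ ℤ) →ₗ[ℤ] ℤ)
    (hq : ∀ z ∈ (K.full J).boundaries p, q z = 0) : K.CHTotal p →ₗ[ℤ] ℤ :=
  (Submodule.liftQ _ (q ∘ₗ ((K.full J).cycles p).subtype) fun z hz => hq z hz) ∘ₗ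
    LinearMap.proj J

theorem evalAt_mk {J : Finset V} {q : (Finset V →₀ ℤ) →ₗ[ℤ] ℤ}
    (hq : ∀ z ∈ (K.full J).boundaries p, q z = 0) (a : ∀ J : Finset V, (K.full J).cycles p) :
    evalAt J q hq (fun J => Submodule.Quotient.mk (a J)) = q (a J) :=
  rfl

/-- The component of a differential at J is a combination of cycles from the sets `J.erase x`, all
killed by q. -/
theorem evalAt_diff {J : Finset V} {q : (Finset V →₀ ℤ) →ₗ[ℤ] ℤ}
    (hq : ∀ z ∈ (K.full J).boundaries p, q z = 0)
    (h : ∀ x ∈ J, ∀ z ∈ (K.full (J.erase x)).cycles p, q z = 0) (c : K.CHTotal p) :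
    evalAt J q hq (K.diff p c) = 0 := by
  obtain ⟨a, rfl⟩ := exists_rep c
  have hd : K.diff p (fun J => Submodule.Quotient.mk (a J)) = fun J =>
      Submodule.Quotient.mk (((p - 1).negOnePow : ℤ) •
        ⟨cubeDiff (fun J => (a J : Finset V →₀ ℤ)) J, cubeDiff_mem_cycles (fun J => (a J).2) J⟩) :=
    funext fun J => diff_mk a J
  rw [hd, evalAt_mk, Submodule.coe_smul, map_smul]
  have h0 : q (cubeDiff (fun J => (a J : Finset V →₀ ℤ)) J) = 0 := by
    rw [← map_cubeDiff]
    exact Finset.sum_eq_zero fun x hx => (congrArg _ (h x hx _ (a _).2)).trans (smul_zero _)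
  rw [h0, smul_zero]

theorem exists_diff_eq_of_isCoboundary {l : ℤ}
    (h : ∀ a, K.IsCocycle p a → (∀ J : Finset V, (J.card : ℤ) ≠ l → a J ∈ (K.full J).boundaries p) →
      K.IsCoboundary p a) {c : K.CHTotal p} (hc : c ∈ K.CHPart p l) (hd : K.diff p c = 0) :
    ∃ b ∈ K.CHPart p (l - 1), K.diff p b = c := by
  obtain ⟨a, rfl⟩ := exists_rep c
  exact exists_diff_eq a hc
    (h _ ((diff_mk_eq_zero_iff a).1 hd) fun J hJ => mk_eq_zero_iff.1 (hc J hJ))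

theorem exists_diff_eq_of_evalAt {l : ℤ} {J : Finset V} {q : (Finset V →₀ ℤ) →ₗ[ℤ] ℤ}
    (hq : ∀ z ∈ (K.full J).boundaries p, q z = 0)
    (h : ∀ a, K.IsCocycle p a → q (a J) = 0 → K.IsCoboundary p a) {c : K.CHTotal p}
    (hc : c ∈ K.CHPart p l) (hd : K.diff p c = 0) (h0 : evalAt J q hq c = 0) :
    ∃ b ∈ K.CHPart p (l - 1), K.diff p b = c := by
  obtain ⟨a, rfl⟩ := exists_rep c
  exact exists_diff_eq a hc (h _ ((diff_mk_eq_zero_iff a).1 hd) h0)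

/-- The criterion `nonempty_doubleHomology_addEquiv` in terms of families of cycles. -/
theorem nonempty_doubleHomology_addEquiv_of_evalAt {J : Finset V} {q : (Finset V →₀ ℤ) →ₗ[ℤ] ℤ}
    (hq : ∀ z ∈ (K.full J).boundaries p, q z = 0)
    (hq' : ∀ x ∈ J, ∀ z ∈ (K.full (J.erase x)).cycles p, q z = 0)
    (h : ∀ a, K.IsCocycle p a → q (a J) = 0 → K.IsCoboundary p a)
    {a : Finset V → Finset V →₀ ℤ} (ha : K.IsCocycle p a) (haJ : q (a J) = 1)
    (hcard : ∀ I : Finset V, I.card ≠ J.card → a I = 0) :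
    Nonempty (K.DoubleHomology p J.card ≃+ ℤ) := by
  refine nonempty_doubleHomology_addEquiv (evalAt J q hq) (fun b _ => evalAt_diff hq hq' b)
    (fun c hc hd h0 => exists_diff_eq_of_evalAt hq h hc hd h0)
    ⟨fun J => Submodule.Quotient.mk ⟨a J, ha.1 J⟩, fun I hI => ?_,
      (diff_mk_eq_zero_iff _).2 ha, haJ⟩
  rw [mk_eq_zero_iff]
  change a I ∈ _
  rw [hcard I fun h => hI (congrArg _ h)]
  exact Submodule.zero_mem _

theorem cycles_eq_bot_of_lt (K : SimplicialCx V) (hp : p < -1) : K.cycles p = ⊥ := by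
  rw [cycles, chains_eq_bot_of_lt K hp, bot_inf_eq]

theorem isCoboundary_of_lt (hp : p < -1) {a : Finset V → Finset V →₀ ℤ}
    (ha : K.IsCocycle p a) : K.IsCoboundary p a := by
  refine ⟨0, fun J => Submodule.zero_mem _, fun J => ?_⟩
  have h := ha.1 J
  rw [cycles_eq_bot_of_lt _ hp, Submodule.mem_bot] at h
  simp [h, cubeDiff]

theorem chains_neg_one_le_boundaries {v : V} (hv : {v} ∈ K.faces) :
    K.chains (-1) ≤ K.boundaries (-1) := by
  intro z hz
  refine ⟨z ∅ • Finsupp.single {v} 1, Submodule.smul_mem _ _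
    (Finsupp.single_mem_supported ℤ _ ⟨hv, by simp⟩), ?_⟩
  rw [map_smul, boundary_singleton, ← sub_eq_zero]
  refine eq_zero_of_mem_chains_neg_one (K := K) (Submodule.sub_mem _ (Submodule.smul_mem _ _
    (Finsupp.single_mem_supported ℤ _ ⟨K.empty_mem, by simp⟩)) hz) ?_
  simp

theorem chains_full_neg_one_le_boundaries (hK : ∀ x, {x} ∈ K.faces) {J : Finset V}
    (hJ : J.Nonempty) : (K.full J).chains (-1) ≤ (K.full J).boundaries (-1) := by
  obtain ⟨v, hv⟩ := hJ
  exact chains_neg_one_le_boundaries (v := v) ⟨hK v, Finset.singleton_subset_iff.2 hv⟩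

/-- Any vertex of J bounds the empty face, so H̃_{-1}(K_J) = 0 for J ≠ ∅ and only the coefficient at
J = ∅ matters. -/
theorem isCoboundary_neg_one (hK : ∀ x, {x} ∈ K.faces) {a : Finset V → Finset V →₀ ℤ}
    (ha : K.IsCocycle (-1) a) (h0 : a ∅ ∅ = 0) : K.IsCoboundary (-1) a := by
  refine ⟨0, fun J => Submodule.zero_mem _, fun J => ?_⟩
  have h : cubeDiff (0 : Finset V → Finset V →₀ ℤ) J = 0 := by simp [cubeDiff]
  rw [h, sub_zero]
  rcases J.eq_empty_or_nonempty with rfl | hJ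
  · rw [eq_zero_of_mem_chains_neg_one (ha.1 ∅).1 h0]
    exact Submodule.zero_mem _
  · exact chains_full_neg_one_le_boundaries hK hJ (ha.1 J).1

theorem apply_empty_of_mem_boundaries {z : Finset V →₀ ℤ}
    (hz : z ∈ (K.full ∅).boundaries (-1)) : z ∅ = 0 := by
  obtain ⟨e, he, rfl⟩ := hz
  refine chains_zero_induction (L := K.full ∅) (f := Finsupp.lapply ∅ ∘ₗ boundary V) (g := 0)
    (fun v hv => ?_) he
  exact absurd (hv.2 (Finset.mem_singleton_self v)) (Finset.notMem_empty v)

theorem nonempty_doubleHomology_neg_one (hK : ∀ x, {x} ∈ K.faces) :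
    Nonempty (K.DoubleHomology (-1) 0 ≃+ ℤ) := by
  let a : Finset V → Finset V →₀ ℤ := fun J => if J = ∅ then Finsupp.single ∅ 1 else 0
  have hc : ∀ J, a J ∈ (K.full J).cycles (-1) := fun J => by
    simp only [a]
    split_ifs
    · refine ⟨Finsupp.single_mem_supported ℤ _ ⟨(K.full J).empty_mem, by simp⟩, ?_⟩
      rw [SetLike.mem_coe, LinearMap.mem_ker, boundary_single, Finset.sum_empty]
    · exact Submodule.zero_mem _
  refine nonempty_doubleHomology_addEquiv_of_evalAt (J := ∅) (q := Finsupp.lapply ∅) (a := a)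
    (fun z hz => apply_empty_of_mem_boundaries hz) (fun x hx => absurd hx (Finset.notMem_empty x))
    (fun a ha h0 => isCoboundary_neg_one hK ha h0) ⟨hc, fun J => ?_⟩ (by simp [a])
    (fun I hI => if_neg fun h => hI (congrArg _ h))
  rcases J.eq_empty_or_nonempty with rfl | hJ
  · rw [cubeDiff, Finset.sum_empty]
    exact Submodule.zero_mem _
  · exact chains_full_neg_one_le_boundaries hK hJ (cubeDiff_mem_cycles hc J).1

/-- The family of the boundaries of all pairs of vertices is a cocycle. -/
theorem isCocycle_boundary_pairs (hK : ∀ x, {x} ∈ K.faces) :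
    K.IsCocycle 0 fun J => if J.card = 2 then boundary V (Finsupp.single J 1) else 0 := by
  refine ⟨fun J => ?_, fun J => ?_⟩
  · beta_reduce
    split_ifs with hJ
    · refine ⟨?_, boundary_boundary _⟩
      rw [boundary_single]
      refine Submodule.sum_mem _ fun x hx => Submodule.smul_mem _ _
        (Finsupp.single_mem_supported ℤ _ ?_)
      have hcard : (J.erase x).card = 1 := by rw [Finset.card_erase_of_mem hx, hJ]
      refine ⟨⟨?_, J.erase_subset x⟩, by rw [hcard]; rfl⟩
      obtain ⟨y, hy⟩ := Finset.card_eq_one.1 hcard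
      exact hy ▸ hK y
    · exact Submodule.zero_mem _
  · suffices h : cubeDiff (fun J => if J.card = 2 then boundary V (Finsupp.single J 1) else 0) J =
        (0 : Finset V →₀ ℤ) by
      rw [h]
      exact Submodule.zero_mem _
    -- For |J| = 3 the cube differential of the family is ∂∂[J]; for other sizes no pair occurs.
    by_cases hJ : J.card = 3
    · refine Eq.trans ?_ (boundary_boundary (Finsupp.single J 1))
      rw [boundary_single, map_sum]
      refine Finset.sum_congr rfl fun x hx => ?_
      beta_reduce
      rw [if_pos (by rw [Finset.card_erase_of_mem hx, hJ]), map_smul]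
    · refine Finset.sum_eq_zero fun x hx => ?_
      have := Finset.card_erase_add_one hx
      beta_reduce
      rw [if_neg (by omega), smul_zero]

theorem IsCocycle.smul {a : Finset V → Finset V →₀ ℤ} (ha : K.IsCocycle p a) (n : ℤ) :
    K.IsCocycle p fun J => n • a J := by
  refine ⟨fun J => Submodule.smul_mem _ _ (ha.1 J), fun J => ?_⟩
  have h : cubeDiff (fun J => n • a J) J = n • cubeDiff a J := by
    simp only [cubeDiff, Finset.smul_sum, smul_comm n]
  rw [h]
  exact Submodule.smul_mem _ _ (ha.2 J)

variable {K₁ K₂ : SimplicialCx V} {τ : Finset V}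

theorem IsFaceSum.disjoint_pair (h : IsFaceSum K K₁ K₂ τ) {x₁ x₂ : V} (hx₁ : K₂.IsGhost x₁)
    (hx₂ : K₁.IsGhost x₂) : Disjoint {x₁, x₂} τ := by
  have hτ : ∀ x, x ∈ τ → {x} ∈ K₁.faces ∧ {x} ∈ K₂.faces := fun x hx =>
    (Set.ext_iff.1 h.inter_eq {x}).2 (Finset.singleton_subset_iff.2 hx)
  rw [Finset.disjoint_insert_left, Finset.disjoint_singleton_left]
  exact ⟨fun hx => hx₁ (hτ _ hx).2, fun hx => hx₂ (hτ _ hx).1⟩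

theorem IsFaceSum.subsingleton_doubleHomology (h : IsFaceSum K K₁ K₂ τ)
    (hK : ∀ x, {x} ∈ K.faces) {l : ℤ} (h1 : (p, l) ≠ (-1, 0)) (h2 : (p, l) ≠ (0, 2)) :
    Subsingleton (K.DoubleHomology p l) := by
  refine SimplicialCx.subsingleton_doubleHomology fun c hc hd =>
    exists_diff_eq_of_isCoboundary (fun a ha hl => ?_) hc hd
  rcases lt_or_ge p (-1) with hp | hp
  · exact isCoboundary_of_lt hp ha
  rcases hp.eq_or_lt with rfl | hp
  · refine isCoboundary_neg_one hK ha (apply_empty_of_mem_boundaries (hl ∅ ?_))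
    rw [Finset.card_empty]
    exact fun h => h1 (by rw [← h]; rfl)
  rcases (show 0 ≤ p by omega).eq_or_lt with rfl | hp
  · obtain ⟨x₁, hx₁, hx₁'⟩ := h.exists_vertex_left
    obtain ⟨x₂, hx₂, hx₂'⟩ := h.symm.exists_vertex_left
    have hne : x₁ ≠ x₂ := fun e => hx₂' (e ▸ hx₁)
    -- As l ≠ 2, the component at {x₁, x₂} is a boundary, so the obstruction vanishes.
    refine h.isCoboundary_of_vertexSum hK hx₁' hx₂' ha
      (vertexSum_of_mem_boundaries h.union_eq h.inter_eq ?_ (hl _ ?_))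
    · exact h.disjoint_pair hx₁' hx₂'
    · rw [Finset.card_pair hne]
      exact fun h => h2 (by rw [← h]; rfl)
  · exact h.isCoboundary_of_one_le hp ha

theorem IsFaceSum.nonempty_doubleHomology_zero_two (h : IsFaceSum K K₁ K₂ τ)
    (hK : ∀ x, {x} ∈ K.faces) : Nonempty (K.DoubleHomology 0 2 ≃+ ℤ) := by
  obtain ⟨x₁, hx₁, hx₁'⟩ := h.exists_vertex_left
  obtain ⟨x₂, hx₂, hx₂'⟩ := h.symm.exists_vertex_left
  have hne : x₁ ≠ x₂ := fun e => hx₂' (e ▸ hx₁)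
  have hcard : ({x₁, x₂} : Finset V).card = 2 := Finset.card_pair hne
  have he₁ : ({x₁, x₂} : Finset V).erase x₁ = {x₂} := by
    rw [Finset.erase_insert (by simpa using hne)]
  have he₂ : ({x₁, x₂} : Finset V).erase x₂ = {x₁} := by
    rw [Finset.pair_comm, Finset.erase_insert (by simpa using hne.symm)]
  have hval : vertexSum K₁ (boundary V (Finsupp.single {x₁, x₂} 1)) = sgn x₂ {x₁, x₂} := by
    rw [boundary_single, Finset.sum_pair hne, he₁, he₂, map_add, map_smul, map_smul,
      vertexSum_single hx₁, vertexSum_single_of_isGhost hx₂', smul_zero, zero_add, smul_eq_mul,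
      mul_one]
  have key := nonempty_doubleHomology_addEquiv_of_evalAt (K := K) (p := 0) (J := {x₁, x₂})
    (q := vertexSum K₁)
    (fun z hz => vertexSum_of_mem_boundaries h.union_eq h.inter_eq (h.disjoint_pair hx₁' hx₂') hz)
    (fun x hx z hz => by
      rcases Finset.mem_insert.1 hx with rfl | hx
      · rw [he₁] at hz
        exact vertexSum_of_subset_right (fun y hy => Finset.mem_singleton.1 hy ▸ hx₂') hz
      · rw [Finset.mem_singleton.1 hx, he₂] at hz
        exact vertexSum_of_subset_left (fun y hy => Finset.mem_singleton.1 hy ▸ hx₁) hz)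
    (fun a ha h0 => h.isCoboundary_of_vertexSum hK hx₁' hx₂' ha h0)
    -- ∂[{x₁, x₂}] has vertex sum `sgn x₂ {x₁, x₂}`; rescaling by this sign normalizes it to 1.
    ((isCocycle_boundary_pairs hK).smul (sgn x₂ {x₁, x₂}))
    (by rw [if_pos hcard, map_smul, hval, smul_eq_mul, sgn_mul_self])
    (fun I hI => by rw [if_neg (hcard ▸ hI), smul_zero])
  rwa [hcard] at key

end Computation

end SimplicialCx

theorem theorem5p4 {V : Type*} [LinearOrder V] [Fintype V] (K : SimplicialCx V)
    (hghost : ∀ x : V, ¬ K.IsGhost x) (hwedge : K.WedgeDecomposable) :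
    (Nonempty (K.HH 0 0 ≃+ ℤ) ∧ Nonempty (K.HH 1 2 ≃+ ℤ) ∧
      ∀ n l : ℤ, (n, l) ≠ (0, 0) → (n, l) ≠ (1, 2) → Subsingleton (K.HH n l)) ∧
    (Nonempty (K.BigradedHH 0 0 ≃+ ℤ) ∧ Nonempty (K.BigradedHH 1 2 ≃+ ℤ) ∧
      ∀ k l : ℤ, (k, l) ≠ (0, 0) → (k, l) ≠ (1, 2) → Subsingleton (K.BigradedHH k l)) := by
  obtain ⟨K₁, K₂, τ, h⟩ := hwedge
  have hK : ∀ x, {x} ∈ K.faces := fun x => not_not.1 (hghost x)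
  have h1 := SimplicialCx.nonempty_doubleHomology_neg_one hK
  have h2 := h.nonempty_doubleHomology_zero_two hK
  -- With p = n - 1 or p = l - k - 1, the pairs (p, l) = (-1, 0) and (0, 2) become (0, 0) and (1, 2)
  -- in both indexings.
  refine ⟨⟨h1, h2, fun n l hn hn' => ?_⟩, h1, h2, fun k l hk hk' => ?_⟩ <;>
    refine h.subsingleton_doubleHomology hK ?_ ?_ <;>
    simp only [ne_eq, Prod.mk.injEq] at * <;> omega
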